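/- Let $U$ be a first-order structure that is stable, i.e. for every formula $\varphi(x;y)$ (with $x,y$ finite tuples of variables) there is a bound on the lengths of sequences $(a_i,b_i)_{i<k}$ of tuples of $U$ with $U\models\varphi(a_i,b_j)\Leftrightarrow i<j$. As usual, $U$ is taken to be sufficiently saturated: for a fixed infinite cardinal $\kappa$, every family of fewer than $\kappa$ definable subsets of a power $U^m$ with the finite intersection property has non-empty intersection (for $\kappa>|L|+\aleph_0$, where $L$ is the language of $U$, this is $\kappa$-saturation). Here "definable" means definable with parameters from $U$, and a set of tuples is $\infty$-definable if it is the intersection of fewer than $\kappa$ definable sets. A monoid whose elements are $n$-tuples of $U$ is called definable (resp. $\infty$-definable) if its underlying set and the graph of its multiplication are definable (resp. $\infty$-definable). A surjective Clifford monoid is a monoid $S$ such that (i) for every $a\in S$ there is a unique $b\in S$ with $aba=a$ and $bab=b$; (ii) every idempotent of $S$ is central; (iii) every $a\in S$ is of the form $a=ge$ with $g$ a unit and $e$ an idempotent of $S$. Let $M\subseteq U^n$ be an $\infty$-definable surjective Clifford monoid. Then there is a definable monoid $N\subseteq U^n$ which is itself a surjective Clifford monoid, such that $M\subseteq N$ and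 the multiplication of $N$ extends that of $M$, with the same neutral element. Furthermore, $M$ is an intersection of definable surjective Clifford monoids: there is a non-empty family $\mathcal F$ of fewer than $\kappa$ subsets of $U^n$ with $M=\bigcap\mathcal F$, such that every $N\in\mathcal F$ carries the structure of a definable surjective Clifford monoid extending that of $M$, with the same neutral element. -/

import Mathlib

open FirstOrder Cardinal

universe u v w

namespace StableMonoid



/-! ### Semigroup theory -/

/-- Every element has exactly one pseudo-inverse. -/
def IsInverseSemigroup (S : Type*) [Semigroup S] : Prop :=
  ∀ a : S, ∃! b : S, a * b * a = a ∧ b * a * b = b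

/-- A Clifford semigroup: an inverse semigroup in which the idempotents are central. -/
def IsCliffordSemigroup (S : Type*) [Semigroup S] : Prop :=
  IsInverseSemigroup S ∧ ∀ e : S, IsIdempotentElem e → ∀ a : S, e * a = a * e

/-- A surjective Clifford monoid: a Clifford monoid in which every element is the product of a unit
and an idempotent. -/
def IsSurjectiveClifford (S : Type*) [Monoid S] : Prop :=
  IsCliffordSemigroup S ∧ ∀ a : S, ∃ (g : Sˣ) (e : S), IsIdempotentElem e ∧ a = g * e

/-! ### Model theory -/

section ModelTheory

variable (L : FirstOrder.Language.{u, v}) (U : Type w) [L.Structure U]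

/-- The structure `U` is stable: no formula `φ(x; y)` (in finite tuples of variables) has the order
property, that is, for each `φ` there is a bound on the length of the sequences `(aᵢ, bᵢ)` from `U`
with `φ(aᵢ, bⱼ) ↔ i < j`. Since the bound is expressed by a sentence, this is a property of the
complete theory of `U`. -/
def IsStable : Prop :=
  ∀ (m k : ℕ) (φ : L.Formula (Fin m ⊕ Fin k)), ∃ N : ℕ,
    ¬ ∃ (a : Fin N → Fin m → U) (b : Fin N → Fin k → U),
      ∀ i j : Fin N, φ.Realize (Sum.elim (a i) (b j)) ↔ i < j

variable {U}

/-- A set of tuples is definable, with arbitrary parameters from the structure. -/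
def IsDefinable {α : Type} (D : Set (α → U)) : Prop :=
  (Set.univ : Set U).Definable L D

variable (U) in
/-- `U` is `κ`-compact: a family of fewer than `κ` definable sets of `n`-tuples with the finite
intersection property has a common point. Every `κ`-saturated structure has this property (as
`κ` is infinite), and for `κ > |L| + ℵ₀` the two notions coincide. -/
def IsKappaCompact (κ : Cardinal.{w}) : Prop :=
  ∀ (n : ℕ) (F : Set (Set (Fin n → U))), #F < κ → (∀ D ∈ F, IsDefinable L D) →
    (∀ F₀ ⊆ F, F₀.Finite → (⋂₀ F₀).Nonempty) → (⋂₀ F).Nonempty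

/-- `X` is `∞`-definable: it is the intersection of a small family (that is, with fewer than `κ`
members) of definable sets. -/
def IsInfDefinable (κ : Cardinal.{w}) {α : Type} (X : Set (α → U)) : Prop :=
  ∃ F : Set (Set (α → U)), #F < κ ∧ (∀ D ∈ F, IsDefinable L D) ∧ X = ⋂₀ F

/-- The graph of the multiplication of a monoid whose elements are `n`-tuples, as a set of
triples of `n`-tuples. -/
def mulGraph {n : ℕ} (M : Set (Fin n → U)) [Monoid M] : Set (Fin n ⊕ Fin n ⊕ Fin n → U) :=
  {t | ∃ a b : M, t = Sum.elim a.1 (Sum.elim b.1 (a * b).1)}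

/-- An `∞`-definable monoid: its underlying set and (the graph of) its multiplication are
`∞`-definable. -/
def IsInfDefinableMonoid (κ : Cardinal.{w}) {n : ℕ} (M : Set (Fin n → U)) [Monoid M] : Prop :=
  IsInfDefinable L κ M ∧ IsInfDefinable L κ (mulGraph M)

/-- A definable monoid: its underlying set and (the graph of) its multiplication are definable. -/
def IsDefinableMonoid {n : ℕ} (N : Set (Fin n → U)) [Monoid N] : Prop :=
  IsDefinable L N ∧ IsDefinable L (mulGraph N)

end ModelTheory

/-- The monoid `N` contains the monoid `M` and extends its multiplication, with the same neutral
element; that is, `M` is a submonoid of `N`. -/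
def Extends {X : Type*} (N M : Set X) [Monoid N] [Monoid M] : Prop :=
  ∃ h : M ⊆ N,
    (∀ a b : M, Set.inclusion h (a * b) = Set.inclusion h a * Set.inclusion h b) ∧
      Set.inclusion h 1 = 1

end StableMonoid

/-! By compactness the multiplication of `M` is the restriction of a total definable operation `m`,
and associativity, neutrality of 1 and centrality of idempotents hold for `m` on a definable set
around `M`, inside any prescribed definable superset. What is missing is closure under `m`. As `M`
is the product of its units and its central idempotents, it suffices to enclose the idempotents in a
definable semilattice `F` and the units in a definable group `H`, both so close to `M` that the
axioms hold on `H * F`. Centrality of `F` then makes `H * F` a surjective Clifford monoid.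

For `F`, stability bounds strict chains of commuting idempotents, so products of idempotents near
`M` yield nothing new after a bounded number of factors (`prodSet_closed`).

For `H`, one wants a definable set invariant under the units, of elements `z` with `g * z` in `Y`
for generic units `g`. The unit group need not be definable, so genericity comes from topological
dynamics (`exists_generic_predicate`): among the limits of rows of the relation take a minimal
closed invariant set. Stability gives it an isolated point, so it is finite, and each of its members
depends on finitely many instances of the relation. `H` consists of the invertible elements that
stabilise the resulting set.

Doing this inside each definable set of a family that cuts out `M` presents `M` as an intersection.
-/

namespace StableMonoid

/-! ### Calculus of definable sets and maps -/

section Definability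

variable {L : FirstOrder.Language.{u, v}} {U : Type w} [L.Structure U]

/-- A definable map between powers of `U`, with arbitrary parameters. -/
abbrev IsDefMap (L : FirstOrder.Language.{u, v}) {U : Type w} [L.Structure U] {α β : Type}
    (T : (α → U) → (β → U)) : Prop :=
  (Set.univ : Set U).DefinableMap L T

theorem IsDefMap.proj {α β : Type} (f : β → α) :
    IsDefMap L (fun (x : α → U) j => x (f j)) := fun j =>
  Set.DefinableFun.proj (i := f j) L

theorem IsDefMap.const {α β : Type} (c : β → U) : IsDefMap L (fun (_ : α → U) => c) := fun j =>
  Language.definableFun_const (a := c j) L _ (Set.mem_univ _)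

theorem IsDefMap.sumElim {α β γ : Type} {S : (α → U) → (β → U)} {T : (α → U) → (γ → U)}
    (hS : IsDefMap L S) (hT : IsDefMap L T) : IsDefMap L (fun x => Sum.elim (S x) (T x)) := by
  rintro (j | j)
  · exact hS j
  · exact hT j

theorem IsDefMap.comp {α β γ : Type} [Finite β] {S : (α → U) → (β → U)} {T : (β → U) → (γ → U)}
    (hT : IsDefMap L T) (hS : IsDefMap L S) : IsDefMap L (fun x => T (S x)) := fun j =>
  Set.DefinableFun.comp hS (hT j)

theorem isDefinable_eq {α β : Type} [Finite β] {S T : (α → U) → (β → U)}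
    (hS : IsDefMap L S) (hT : IsDefMap L T) : IsDefinable L {x | S x = T x} := by
  have : {x | S x = T x} = ⋂ j, {x | S x j = T x j} := by
    ext x; simp [funext_iff]
  rw [this]
  exact Set.definable_iInter_of_finite fun j => (hS j).ofPred_eq (hT j)

theorem isDefinable_mem {α β : Type} [Finite β] {T : (α → U) → (β → U)} (hT : IsDefMap L T)
    {D : Set (β → U)} (hD : IsDefinable L D) : IsDefinable L {x | T x ∈ D} :=
  Set.Definable.preimage_map hT hD

theorem isDefinable_and {α : Type} {p q : (α → U) → Prop} (hp : IsDefinable L {x | p x})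
    (hq : IsDefinable L {x | q x}) : IsDefinable L {x | p x ∧ q x} :=
  Set.Definable.inter hp hq

theorem isDefinable_or {α : Type} {p q : (α → U) → Prop} (hp : IsDefinable L {x | p x})
    (hq : IsDefinable L {x | q x}) : IsDefinable L {x | p x ∨ q x} :=
  Set.Definable.union hp hq

theorem isDefinable_not {α : Type} {p : (α → U) → Prop} (hp : IsDefinable L {x | p x}) :
    IsDefinable L {x | ¬ p x} :=
  Set.Definable.compl hp

theorem isDefinable_imp {α : Type} {p q : (α → U) → Prop} (hp : IsDefinable L {x | p x})
    (hq : IsDefinable L {x | q x}) : IsDefinable L {x | p x → q x} := by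
  have := isDefinable_or (isDefinable_not hp) hq
  simpa only [imp_iff_not_or] using this

theorem isDefinable_exists {α β : Type} [Finite β] {p : (α → U) → (β → U) → Prop}
    (hp : IsDefinable L {y : α ⊕ β → U | p (fun i => y (.inl i)) (fun j => y (.inr j))}) :
    IsDefinable L {x | ∃ v, p x v} :=
  Set.Definable.exists_of_finite hp

theorem isDefinable_forall {α β : Type} [Finite β] {p : (α → U) → (β → U) → Prop}
    (hp : IsDefinable L {y : α ⊕ β → U | p (fun i => y (.inl i)) (fun j => y (.inr j))}) :
    IsDefinable L {x | ∀ v, p x v} :=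
  Set.Definable.forall_of_finite hp

/-- A set that is a union of fibres of finitely many definable predicates is definable. -/
theorem isDefinable_of_finite_invariant {α : Type} {I : Type*} (s : Finset I)
    (p : I → (α → U) → Prop) (hp : ∀ i, IsDefinable L {x | p i x}) {q : (α → U) → Prop}
    (h : ∀ x y, (∀ i ∈ s, p i x ↔ p i y) → (q x ↔ q y)) : IsDefinable L {x | q x} := by
  classical
  -- One piece for each truth pattern `t` on `s` that is realised by a point satisfying `q`.
  have key : {x | q x} = ⋃ t ∈ (s.powerset.filter fun t => ∃ y, q y ∧ ∀ i ∈ s, i ∈ t ↔ p i y),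
      ⋂ i ∈ s, {x | i ∈ t ↔ p i x} := by
    ext x
    simp only [Set.mem_ofPred_eq, Finset.mem_filter, Finset.mem_powerset, Set.mem_iUnion,
      Set.mem_iInter, exists_prop]
    constructor
    · intro hx
      exact ⟨s.filter fun i => p i x, ⟨Finset.filter_subset _ _, x, hx, by simp +contextual⟩,
        by simp +contextual⟩
    · rintro ⟨t, ⟨-, y, hy, hty⟩, htx⟩
      exact (h x y fun i hi => (htx i hi).symm.trans (hty i hi)).2 hy
  rw [key]
  refine Set.definable_biUnion_finset (fun t => Set.definable_biInter_finset (fun i => ?_) _) _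
  by_cases hi : i ∈ t
  · simpa [hi] using! hp i
  · simpa [hi] using! isDefinable_not (hp i)

end Definability

/-! ### Stability for relations definable with parameters -/

section Stability

/-- A half-graph of length `N` inside the relation `R`. -/
def HasLadder {A B : Type*} (R : A → B → Prop) (N : ℕ) : Prop :=
  ∃ (a : Fin N → A) (b : Fin N → B), ∀ i j : Fin N, R (a i) (b j) ↔ i < j

variable {L : FirstOrder.Language.{u, v}} {U : Type w} [L.Structure U]

/-- Only finitely many parameters occur; appended to every `b j`, they turn a ladder of `R` into one
of a parameter-free formula. -/
theorem IsStable.exists_not_hasLadder (hst : IsStable L U) {β γ : Type} [Finite β] [Finite γ]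
    {R : (β → U) → (γ → U) → Prop}
    (hR : IsDefinable L {y : β ⊕ γ → U | R (fun i => y (.inl i)) (fun j => y (.inr j))}) :
    ∃ N, ¬ HasLadder R N := by
  obtain ⟨A₀, -, hA₀⟩ := Set.definable_iff_finitely_definable.1 hR
  obtain ⟨φ, hφ⟩ := Set.definable_iff_exists_formula_sum.1 hA₀
  obtain ⟨m, ⟨e⟩⟩ := Finite.exists_equiv_fin β
  obtain ⟨k, ⟨f⟩⟩ := Finite.exists_equiv_fin ((A₀ : Set U) ⊕ γ)
  let g : (A₀ : Set U) ⊕ (β ⊕ γ) → Fin m ⊕ Fin k :=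
    Sum.elim (fun c => .inr (f (.inl c))) (Sum.elim (fun i => .inl (e i)) fun j => .inr (f (.inr j)))
  obtain ⟨N, hN⟩ := hst m k (φ.relabel g)
  refine ⟨N, fun ⟨a, b, hab⟩ => hN ⟨fun i l => a i (e.symm l),
    fun j l => Sum.elim (fun c : (A₀ : Set U) => (c : U)) (b j) (f.symm l), fun i j => ?_⟩⟩
  rw [← hab i j, Language.Formula.realize_relabel]
  have h2 : Sum.elim (a i) (b j) ∈ {y : β ⊕ γ → U | R (fun i => y (.inl i)) (fun j => y (.inr j))} ↔
      R (a i) (b j) := Iff.rfl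
  rw [← h2, hφ]
  refine iff_of_eq (congrArg φ.Realize ?_)
  ext (c | l | l) <;> simp [g]

end Stability

/-! ### Compactness and extension of the multiplication -/

section Compactness

variable {L : FirstOrder.Language.{u, v}} {U : Type w} [L.Structure U] {κ : Cardinal.{w}}

theorem IsKappaCompact.iInter_nonempty (hU : IsKappaCompact L U κ) {α : Type} [Finite α]
    {I : Type w} (hI : #I < κ) (D : I → Set (α → U)) (hD : ∀ i, IsDefinable L (D i))
    (h : ∀ s : Finset I, ∃ x, ∀ i ∈ s, x ∈ D i) : ∃ x, ∀ i, x ∈ D i := by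
  classical
  obtain ⟨k, ⟨e⟩⟩ := Finite.exists_equiv_fin α
  let E : I → Set (Fin k → U) := fun i => {y | (fun a => y (e a)) ∈ D i}
  obtain ⟨y, hy⟩ := hU k (Set.range E) (mk_range_le.trans_lt hI)
    (by rintro _ ⟨i, rfl⟩; exact isDefinable_mem (IsDefMap.proj e) (hD i)) (by
      intro F₀ hF₀ hfin
      choose c hc using fun Z : F₀ => hF₀ Z.2
      have := hfin.fintype
      obtain ⟨x, hx⟩ := h (Finset.univ.image c)
      refine ⟨fun i => x (e.symm i), fun Z hZ => ?_⟩
      have h1 := hx (c ⟨Z, hZ⟩) (Finset.mem_image_of_mem c (Finset.mem_univ _))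
      rw [← show _ = Z from hc ⟨Z, hZ⟩]
      simpa [E] using h1)
  exact ⟨fun a => y (e a), fun i => hy (E i) ⟨i, rfl⟩⟩

theorem mk_option_lt (hκ : ℵ₀ ≤ κ) {I : Type w} (hI : #I < κ) : #(Option I) < κ := by
  rw [mk_option]
  exact add_lt_of_lt hκ hI (one_lt_aleph0.trans_le hκ)

theorem isDefinable_finset_inter {α : Type} {F : Set (Set (α → U))}
    (hF : ∀ D ∈ F, IsDefinable L D) (s : Finset F) :
    IsDefinable L {x : α → U | ∀ D ∈ s, x ∈ D.1} := by
  have : {x : α → U | ∀ D ∈ s, x ∈ D.1} = ⋂ D ∈ s, D.1 := by ext; simp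
  rw [this]
  exact Set.definable_biInter_finset (fun D => hF _ D.2) _

/-- A definable property of tuples from an `∞`-definable set holds on a definable superset. -/
theorem IsInfDefinable.exists_superset (hκ : ℵ₀ ≤ κ) (hU : IsKappaCompact L U κ) {β ι : Type}
    [Finite ι] [Finite β] {M : Set (β → U)} (hM : IsInfDefinable L κ M)
    {P : (ι → β → U) → Prop}
    (hP : IsDefinable L {x : ι × β → U | P fun i j => x (i, j)})
    (h : ∀ t : ι → β → U, (∀ i, t i ∈ M) → P t) :
    ∃ X : Set (β → U), IsDefinable L X ∧ M ⊆ X ∧ ∀ t : ι → β → U, (∀ i, t i ∈ X) → P t := by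
  obtain ⟨F, hFκ, hF, rfl⟩ := hM
  by_contra! hcon
  -- The index `none` says that `P` fails, the others put every component in `M`. Failure of the
  -- claim makes this family finitely satisfiable.
  let D : Option F → Set (ι × β → U) := fun o =>
    o.elim {x | ¬ P fun i j => x (i, j)} fun Z => ⋂ i, {x | (fun j => x (i, j)) ∈ Z.1}
  obtain ⟨x, hx⟩ := hU.iInter_nonempty (mk_option_lt hκ hFκ) D (by
      rintro (_ | Z)
      · exact isDefinable_not hP
      · exact Set.definable_iInter_of_finite fun i =>
          isDefinable_mem (IsDefMap.proj fun j => (i, j)) (hF _ Z.2)) (by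
      intro s
      obtain ⟨t, ht, hPt⟩ := hcon _ (isDefinable_finset_inter hF s.eraseNone)
        (fun x hx Z _ => hx Z.1 Z.2)
      refine ⟨fun p => t p.1 p.2, ?_⟩
      rintro (_ | Z) hZ
      · exact hPt
      · exact Set.mem_iInter.2 fun i => ht i Z (by simpa using hZ))
  refine hx none (h _ fun i Z hZ => ?_)
  exact Set.mem_iInter.1 (hx (some ⟨Z, hZ⟩)) i

/-- The multiplication of a monoid with `∞`-definable graph is the restriction of a definable
map. -/
theorem exists_definable_mul (hκ : ℵ₀ ≤ κ) (hU : IsKappaCompact L U κ) {n : ℕ}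
    {M : Set (Fin n → U)} [Monoid M] (hM : IsInfDefinable L κ (mulGraph M)) :
    ∃ m : (Fin n → U) → (Fin n → U) → (Fin n → U),
      IsDefMap L (fun x : Fin n ⊕ Fin n → U => m (fun j => x (.inl j)) (fun j => x (.inr j))) ∧
      ∀ a b : M, m a.1 b.1 = (a * b).1 := by
  classical
  obtain ⟨F, hFκ, hF, hFM⟩ := hM
  -- Two points of the graph over the same pair of arguments with different values: inconsistent, so
  -- finitely many members of `F` already define a partial function `G`.
  let D : Option F → Set ((Fin n ⊕ Fin n ⊕ Fin n) ⊕ Fin n → U) := fun o =>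
    o.elim {x | ¬ (fun j => x (.inl (.inr (.inr j)))) = fun j => x (.inr j)}
      fun Z => {x | (fun j => x (.inl j)) ∈ Z.1 ∧
        (Sum.elim (fun j => x (.inl (.inl j)))
          (Sum.elim (fun j => x (.inl (.inr (.inl j)))) (fun j => x (.inr j)))) ∈ Z.1}
  have hD : ∀ o, IsDefinable L (D o) := by
    rintro (_ | Z)
    · exact isDefinable_not (isDefinable_eq (IsDefMap.proj _) (IsDefMap.proj _))
    · exact isDefinable_and (isDefinable_mem (IsDefMap.proj _) (hF _ Z.2))
        (isDefinable_mem ((IsDefMap.proj _).sumElim ((IsDefMap.proj _).sumElim (IsDefMap.proj _)))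
          (hF _ Z.2))
  have hnone : ¬ ∃ x, ∀ o, x ∈ D o := by
    rintro ⟨x, hx⟩
    have h1 : (fun j => x (.inl j)) ∈ mulGraph M := by
      rw [hFM]; exact fun Z hZ => (hx (some ⟨Z, hZ⟩)).1
    have h2 : (Sum.elim (fun j => x (.inl (.inl j)))
          (Sum.elim (fun j => x (.inl (.inr (.inl j)))) (fun j => x (.inr j)))) ∈ mulGraph M := by
      rw [hFM]; exact fun Z hZ => (hx (some ⟨Z, hZ⟩)).2
    obtain ⟨a, b, hab⟩ := h1
    obtain ⟨a', b', hab'⟩ := h2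
    have ea : a = a' := Subtype.ext (funext fun j => by
      have e1 := congrFun hab (.inl j)
      have e2 := congrFun hab' (.inl j)
      simp only [Sum.elim_inl] at e1 e2
      exact e1.symm.trans e2)
    have eb : b = b' := Subtype.ext (funext fun j => by
      have e1 := congrFun hab (.inr (.inl j))
      have e2 := congrFun hab' (.inr (.inl j))
      simp only [Sum.elim_inl, Sum.elim_inr] at e1 e2
      exact e1.symm.trans e2)
    subst ea eb
    refine hx none (funext fun j => ?_)
    have e1 := congrFun hab (.inr (.inr j))
    have e2 := congrFun hab' (.inr (.inr j))
    simp only [Sum.elim_inr] at e1 e2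
    exact e1.trans e2.symm
  have hs := mt (hU.iInter_nonempty (mk_option_lt hκ hFκ) D hD) hnone
  push Not at hs
  obtain ⟨s, hs⟩ := hs
  let G : (Fin n → U) → (Fin n → U) → (Fin n → U) → Prop := fun a b c =>
    ∀ Z ∈ s.eraseNone, Sum.elim a (Sum.elim b c) ∈ Z.1
  have hGdef : IsDefinable L {x : Fin n ⊕ Fin n ⊕ Fin n → U | ∀ Z ∈ s.eraseNone, x ∈ Z.1} :=
    isDefinable_finset_inter hF _
  have hGfun : ∀ a b c c', G a b c → G a b c' → c = c' := by
    intro a b c c' h h'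
    by_contra hcc
    obtain ⟨o, ho, hno⟩ := hs (Sum.elim (Sum.elim a (Sum.elim b c)) c')
    rcases o with _ | Z
    · exact hno hcc
    · exact hno ⟨h Z (by simpa using ho), h' Z (by simpa using ho)⟩
  have hGM : ∀ a b : M, G a.1 b.1 (a * b).1 := fun a b Z _ => by
    have : Sum.elim a.1 (Sum.elim b.1 (a * b).1) ∈ mulGraph M := ⟨a, b, rfl⟩
    rw [hFM] at this
    exact this Z.1 Z.2
  -- The default value 1 off the domain of `G` only serves to make the map total and definable.
  let m : (Fin n → U) → (Fin n → U) → (Fin n → U) := fun a b =>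
    if h : ∃ c, G a b c then h.choose else (1 : M).1
  have hmG : ∀ a b c, m a b = c ↔ G a b c ∨ ((¬ ∃ c', G a b c') ∧ c = (1 : M).1) := by
    intro a b c
    by_cases h : ∃ c, G a b c
    · have h' := h.choose_spec
      simp only [m, dif_pos h, h, not_true_eq_false, false_and, or_false]
      exact ⟨fun hc => hc ▸ h', fun hc => hGfun _ _ _ _ h' hc⟩
    · have h1 : ¬ G a b c := fun hc => h ⟨c, hc⟩
      simp only [m, dif_neg h, h, h1, not_false_eq_true, true_and, false_or]
      exact eq_comm
  have hgraph : IsDefinable L {x : (Fin n ⊕ Fin n) ⊕ Fin n → U |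
      m (fun j => x (.inl (.inl j))) (fun j => x (.inl (.inr j))) = fun j => x (.inr j)} := by
    simp only [hmG]
    refine isDefinable_or (isDefinable_mem
      ((IsDefMap.proj _).sumElim ((IsDefMap.proj _).sumElim (IsDefMap.proj _))) hGdef)
      (isDefinable_and (isDefinable_not (isDefinable_exists (isDefinable_mem
      ((IsDefMap.proj _).sumElim ((IsDefMap.proj _).sumElim (IsDefMap.proj _))) hGdef)))
        (isDefinable_eq (IsDefMap.proj _) (IsDefMap.const _)))
  refine ⟨m, fun j => ?_, fun a b => (hmG _ _ _).2 (Or.inl (hGM a b))⟩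
  have h3 : IsDefinable L {x : Option (Fin n ⊕ Fin n) → U | ∃ v : Fin n → U,
      m (fun j => x (some (.inl j))) (fun j => x (some (.inr j))) = v ∧
        (fun _ : Unit => x none) = fun _ => v j} :=
    isDefinable_exists (isDefinable_and
      (isDefinable_mem (T := fun (y : Option (Fin n ⊕ Fin n) ⊕ Fin n → U) =>
        Sum.elim (fun j => y (.inl (some j))) fun j => y (.inr j))
        ((IsDefMap.proj _).sumElim (IsDefMap.proj _)) hgraph)
      (isDefinable_eq (IsDefMap.proj _) (IsDefMap.proj _)))
  refine (congrArg (IsDefinable L) ?_).mp h3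
  ext x
  simp only [Function.tupleGraph, Set.mem_ofPred_eq, funext_iff, forall_const]
  exact ⟨fun ⟨v, hv, hx⟩ => (hv j).trans hx.symm, fun h => ⟨_, fun _ => rfl, h.symm⟩⟩

end Compactness

/-! ### Combinatorics of relations without long half-graphs -/

section Ladders

open Filter

/-- The next index is picked from a finite intersection of sets in `l`; `l ≤ cofinite` lets it
exceed the earlier ones. -/
theorem exists_seq_of_eventually {c : ℕ → ℕ → Prop} {l : Filter ℕ} [l.NeBot] (hl : l ≤ cofinite)
    (h : ∀ᶠ i in l, ∀ᶠ j in l, c i j) :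
    ∃ g : ℕ → ℕ, ∀ i j, i < j → g i < g j ∧ c (g i) (g j) := by
  obtain ⟨g, -, hg⟩ := exists_seq_of_forall_finset_exists (fun i => ∀ᶠ j in l, c i j)
    (fun i j => i < j ∧ c i j) (fun s hs => by
      have h1 : ∀ᶠ j in l, ∀ i ∈ s, i < j ∧ c i j := by
        refine (Filter.eventually_all_finset s).2 fun i hi => Filter.Eventually.and ?_ (hs i hi)
        rw [Nat.cofinite_eq_atTop] at hl
        exact hl (eventually_gt_atTop i)
      exact (h.and h1).exists)
  exact ⟨g, hg⟩

/-- Infinite Ramsey theorem for pairs and two colours. -/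
theorem exists_homogeneous_seq (c : ℕ → ℕ → Prop) :
    ∃ g : ℕ → ℕ, (∀ i j, i < j → g i < g j) ∧
      ((∀ i j, i < j → c (g i) (g j)) ∨ (∀ i j, i < j → ¬ c (g i) (g j))) := by
  have hl : (hyperfilter ℕ : Filter ℕ) ≤ cofinite := hyperfilter_le_cofinite
  by_cases h : ∀ᶠ i in (hyperfilter ℕ : Filter ℕ), ∀ᶠ j in (hyperfilter ℕ : Filter ℕ), c i j
  · obtain ⟨g, hg⟩ := exists_seq_of_eventually hl h
    exact ⟨g, fun i j hij => (hg i j hij).1, Or.inl fun i j hij => (hg i j hij).2⟩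
  · rw [← Ultrafilter.eventually_not] at h
    simp only [← Ultrafilter.eventually_not] at h
    obtain ⟨g, hg⟩ := exists_seq_of_eventually hl h
    exact ⟨g, fun i j hij => (hg i j hij).1, Or.inr fun i j hij => (hg i j hij).2⟩

/-- A limit of the rows of a stable relation factors through finitely many rows. -/
theorem exists_finset_factors {A B : Type*} {R : A → B → Prop} {N : ℕ} (hN : ¬ HasLadder R N)
    {χ : B → Prop} (hχ : ∀ s : Finset B, ∃ a, ∀ b ∈ s, R a b ↔ χ b) :
    ∃ s : Finset A, ∀ b b', (∀ a ∈ s, R a b ↔ R a b') → (χ b ↔ χ b') := by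
  classical
  by_contra! hcon
  have hcon' : ∀ s : Finset A, ∃ b b', (∀ a ∈ s, R a b ↔ R a b') ∧ χ b ∧ ¬ χ b' := by
    intro s
    obtain ⟨b, b', h1, h2⟩ := hcon s
    by_cases hb : χ b
    · exact ⟨b, b', h1, hb, by tauto⟩
    · exact ⟨b', b, fun a ha => (h1 a ha).symm, by tauto, hb⟩
  -- Each new triple `(a, b, b')` has `b`, `b'` separated by `χ` but not by the earlier rows, and a
  -- row `a` agreeing with `χ` on all points so far.
  obtain ⟨f, hf1, hf2⟩ := exists_seq_of_forall_finset_exists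
    (fun t : A × B × B => χ t.2.1 ∧ ¬ χ t.2.2 ∧ R t.1 t.2.1 ∧ ¬ R t.1 t.2.2)
    (fun t t' => (R t.1 t'.2.1 ↔ R t.1 t'.2.2) ∧ R t'.1 t.2.1 ∧ ¬ R t'.1 t.2.2) (fun s hs => by
      obtain ⟨b, b', h1, h2, h3⟩ := hcon' (s.image fun t => t.1)
      obtain ⟨a, ha⟩ := hχ ({b, b'} ∪ s.image (fun t => t.2.1) ∪ s.image (fun t => t.2.2))
      refine ⟨(a, b, b'), ⟨h2, h3, (ha b (by simp)).2 h2, mt (ha b' (by simp)).1 h3⟩,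
        fun t ht => ⟨h1 _ (Finset.mem_image_of_mem _ ht), ?_, ?_⟩⟩
      · refine (ha _ ?_).2 (hs t ht).1
        exact Finset.mem_union_left _ (Finset.mem_union_right _
          (Finset.mem_image_of_mem (fun t => t.2.1) ht))
      · refine mt (ha _ ?_).1 (hs t ht).2.1
        exact Finset.mem_union_right _ (Finset.mem_image_of_mem (fun t => t.2.2) ht))
  obtain ⟨g, hg, hc | hc⟩ := exists_homogeneous_seq fun i j => R (f i).1 (f j).2.1
  · refine hN ⟨fun i => (f (g i)).1, fun i => (f (g i)).2.2, fun i j => ?_⟩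
    rcases lt_trichotomy i j with h | rfl | h
    · exact iff_of_true ((hf2 _ _ (hg _ _ h)).1.1 (hc _ _ h)) h
    · exact iff_of_false (hf1 _).2.2.2 (lt_irrefl _)
    · exact iff_of_false (hf2 _ _ (hg _ _ h)).2.2 h.asymm
  -- Here `R` holds exactly when the row index is at least the point index. Reversing the order and
  -- shifting the points by one makes the diagonal false.
  · refine hN ⟨fun i => (f (g (N - i))).1, fun i => (f (g (N + 1 - i))).2.1, fun i j => ?_⟩
    rcases lt_trichotomy ((N + 1 - j : ℕ)) (N - i : ℕ) with h | h | h
    · exact iff_of_true (hf2 _ _ (hg _ _ h)).2.1 (Fin.lt_def.2 (by omega))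
    · simp only [h]
      exact iff_of_true (hf1 _).2.2.1 (Fin.lt_def.2 (by omega))
    · exact iff_of_false (hc _ _ h) (fun hij => by have := Fin.lt_def.1 hij; omega)

/-- The rows of a stable relation have an isolated point. -/
theorem exists_isolated_row {K P : Type*} [Nonempty K] {R : K → P → Prop} {N : ℕ}
    (hN : ¬ HasLadder R N) :
    ∃ (x : K) (s : Finset P), ∀ y, (∀ p ∈ s, R y p ↔ R x p) → ∀ p, R y p ↔ R x p := by
  classical
  by_contra! hcon
  choose f hf p hp using hcon
  -- Without isolated rows a binary tree grows: a node carries a row and the finite set of points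
  -- already decided, and its children take both values at a new point.
  let node : List Bool → K × Finset P := fun l => l.rec (Classical.arbitrary K, ∅) fun b _ r =>
    (if R r.1 (p r.1 r.2) ↔ b = true then r.1 else f r.1 r.2, insert (p r.1 r.2) r.2)
  let q : List Bool → P := fun l => p (node l).1 (node l).2
  have hnode1 : ∀ b l, (node (b :: l)).1 =
      if R (node l).1 (q l) ↔ b = true then (node l).1 else f (node l).1 (node l).2 :=
    fun _ _ => rfl
  have hnode2 : ∀ b l, (node (b :: l)).2 = insert (q l) (node l).2 := fun _ _ => rfl
  have hq : ∀ b l, R (node (b :: l)).1 (q l) ↔ b = true := by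
    intro b l
    rw [hnode1]
    split_ifs with h
    · exact h
    · have := hp (node l).1 (node l).2
      simp only [q] at h ⊢
      tauto
  have hkeep : ∀ b l, ∀ x ∈ (node l).2, (R (node (b :: l)).1 x ↔ R (node l).1 x) := by
    intro b l x hx
    rw [hnode1]
    split_ifs with h
    · rfl
    · exact hf _ _ x hx
  let path : (ℕ → Bool) → ℕ → List Bool := fun σ n => n.rec [] fun n l => σ n :: l
  have hpath : ∀ σ n, path σ (n + 1) = σ n :: path σ n := fun _ _ => rfl
  have hbranch : ∀ σ i n, i < n →
      q (path σ i) ∈ (node (path σ n)).2 ∧ (R (node (path σ n)).1 (q (path σ i)) ↔ σ i = true) := by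
    intro σ i n hin
    induction n with
    | zero => omega
    | succ n ih =>
      rw [hpath]
      rcases Nat.lt_succ_iff_lt_or_eq.1 hin with h | rfl
      · obtain ⟨h1, h2⟩ := ih h
        exact ⟨by rw [hnode2]; exact Finset.mem_insert_of_mem h1, (hkeep _ _ _ h1).trans h2⟩
      · exact ⟨by rw [hnode2]; exact Finset.mem_insert_self _ _, hq _ _⟩
  -- Indexing by nodes makes rows and points countable. Each branch has a limit `χ σ` that remembers
  -- `σ`, yet is coded by finite data; this bounds the branches by a countable set.
  let R' : List Bool → List Bool → Prop := fun l l' => R (node l).1 (q l')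
  have hN' : ¬ HasLadder R' N := fun ⟨a, b, h⟩ => hN ⟨fun i => (node (a i)).1, fun i => q (b i), h⟩
  let χ : (ℕ → Bool) → List Bool → Prop := fun σ l =>
    ∀ᶠ n in (hyperfilter ℕ : Filter ℕ), R' (path σ n) l
  have hχ : ∀ σ, ∀ s : Finset (List Bool), ∃ a, ∀ b ∈ s, R' a b ↔ χ σ b := by
    intro σ s
    have : ∀ᶠ n in (hyperfilter ℕ : Filter ℕ), ∀ b ∈ s, R' (path σ n) b ↔ χ σ b := by
      refine (Filter.eventually_all_finset s).2 fun b _ => ?_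
      by_cases hb : χ σ b
      · filter_upwards [hb] with n hn using iff_of_true hn hb
      · filter_upwards [Ultrafilter.eventually_not.2 hb] with n hn using iff_of_false hn hb
    obtain ⟨n, hn⟩ := this.exists
    exact ⟨_, hn⟩
  have hχσ : ∀ σ i, χ σ (path σ i) ↔ σ i = true := by
    intro σ i
    have h1 : ∀ᶠ n in (hyperfilter ℕ : Filter ℕ), i < n := by
      have := hyperfilter_le_cofinite (α := ℕ)
      rw [Nat.cofinite_eq_atTop] at this
      exact this (eventually_gt_atTop i)
    constructor
    · intro h
      obtain ⟨n, hn1, hn2⟩ := (h1.and h).exists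
      exact (hbranch σ i n hn1).2.1 hn2
    · intro h
      filter_upwards [h1] with n hn using (hbranch σ i n hn).2.2 h
  choose s hs using fun σ => exists_finset_factors hN' (hχ σ)
  let code : (ℕ → Bool) → Finset (List Bool) × Finset (Finset (List Bool)) := fun σ =>
    (s σ, (s σ).powerset.filter fun t => ∃ b, χ σ b ∧ t = (s σ).filter fun a => R' a b)
  have hcode : ∀ σ b, χ σ b ↔ ((code σ).1.filter fun a => R' a b) ∈ (code σ).2 := by
    intro σ b
    simp only [code, Finset.mem_filter, Finset.mem_powerset, Finset.filter_subset, true_and]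
    refine ⟨fun h => ⟨b, h, rfl⟩, fun ⟨b', hb', h⟩ => (hs σ b b' fun a ha => ?_).2 hb'⟩
    have := Finset.ext_iff.1 h a
    simpa [ha] using this
  have hinj : Function.Injective code := by
    intro σ τ h
    have hχeq : ∀ b, χ σ b ↔ χ τ b := fun b => by rw [hcode, hcode, h]
    have hp : ∀ n, path σ n = path τ n := by
      intro n
      induction n with
      | zero => rfl
      | succ n ih =>
        have : σ n = τ n := by
          rw [Bool.eq_iff_iff, ← hχσ, ← hχσ, hχeq, ih]
        rw [hpath, hpath, ih, this]
    funext n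
    have := hp (n + 1)
    rw [hpath, hpath] at this
    exact (List.cons.inj this).1
  have := hinj.countable
  obtain ⟨g, hg⟩ := exists_injective_nat (ℕ → Bool)
  classical
  refine Function.cantor_injective (fun S : Set ℕ => g fun n => decide (n ∈ S)) fun S T h => ?_
  ext n
  simpa using congrFun (hg h) n

end Ladders

/-! ### Minimal invariant sets of limits, and genericity -/

section Dynamics

/-- Right translation on functions on `G × V`. -/
def translate {G V : Type*} [Group G] (h : G) (χ : G × V → Bool) : G × V → Bool :=
  fun p => χ (h * p.1, p.2)

theorem translate_translate {G V : Type*} [Group G] (h h' : G) (χ : G × V → Bool) :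
    translate h (translate h' χ) = translate (h' * h) χ := by
  funext p; simp [translate, mul_assoc]

theorem translate_one {G V : Type*} [Group G] (χ : G × V → Bool) : translate 1 χ = χ := by
  funext p; simp [translate]

theorem continuous_translate {G V : Type*} [Group G] (h : G) :
    Continuous (translate h : (G × V → Bool) → _) :=
  continuous_pi fun p => continuous_apply (h * p.1, p.2)

theorem isOpen_cylinder {P : Type*} (s : Finset P) (χ : P → Bool) :
    IsOpen {ψ : P → Bool | ∀ p ∈ s, ψ p = χ p} := by
  have : {ψ : P → Bool | ∀ p ∈ s, ψ p = χ p} = ⋂ p ∈ s, (fun ψ => ψ p) ⁻¹' {χ p} := by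
    ext; simp
  rw [this]
  exact isOpen_biInter_finset fun p _ => (isOpen_discrete _).preimage (continuous_apply p)

/-- A stable relation on a group has a finite non-empty invariant set of limits of rows. -/
theorem exists_finite_invariant_limits {G V : Type*} [Group G] {φ : G → V → Prop} {N : ℕ}
    (hN : ¬ HasLadder (fun (a : G) (p : G × V) => φ (a * p.1) p.2) N) :
    ∃ K : Set (G × V → Bool), K.Finite ∧ K.Nonempty ∧ (∀ h, ∀ χ ∈ K, translate h χ ∈ K) ∧
      ∀ χ ∈ K, ∀ s : Finset (G × V), ∃ a, ∀ p ∈ s, φ (a * p.1) p.2 ↔ χ p = true := by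
  classical
  let row : G → G × V → Bool := fun a p => decide (φ (a * p.1) p.2)
  have hrow : ∀ h a, translate h (row a) = row (a * h) := fun h a => by
    funext p; simp [translate, row, mul_assoc]
  let C := closure (Set.range row)
  have hC : ∀ χ ∈ C, ∀ s : Finset (G × V), ∃ a, ∀ p ∈ s, φ (a * p.1) p.2 ↔ χ p = true := by
    intro χ hχ s
    obtain ⟨_, h1, a, rfl⟩ := mem_closure_iff.1 hχ _ (isOpen_cylinder s χ) (fun _ _ => rfl)
    exact ⟨a, fun p hp => by rw [← h1 p hp]; simp [row]⟩
  have hinv_closure : ∀ S : Set (G × V → Bool), (∀ h, ∀ χ ∈ S, translate h χ ∈ S) →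
      ∀ h, ∀ χ ∈ closure S, translate h χ ∈ closure S := fun S hS h χ hχ =>
    map_mem_closure (continuous_translate h) hχ (fun ψ hψ => hS h ψ hψ)
  let 𝒮 : Set (Set (G × V → Bool)) :=
    {S | S ⊆ C ∧ IsClosed S ∧ S.Nonempty ∧ ∀ h, ∀ χ ∈ S, translate h χ ∈ S}
  have hC𝒮 : C ∈ 𝒮 := ⟨le_rfl, isClosed_closure, ⟨row 1, subset_closure ⟨1, rfl⟩⟩,
    hinv_closure _ (by rintro h _ ⟨a, rfl⟩; exact ⟨a * h, (hrow h a).symm⟩)⟩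
  obtain ⟨K, hK⟩ := zorn_superset 𝒮 (by
    intro c hc hchain
    rcases c.eq_empty_or_nonempty with rfl | hne
    · exact ⟨C, hC𝒮, by simp⟩
    · have := hne.to_subtype
      refine ⟨⋂₀ c, ⟨?_, ?_, ?_, ?_⟩, fun s hs => Set.sInter_subset_of_mem hs⟩
      · obtain ⟨S, hS⟩ := hne
        exact (Set.sInter_subset_of_mem hS).trans (hc hS).1
      · exact isClosed_sInter fun S hS => (hc hS).2.1
      · exact IsCompact.nonempty_sInter_of_directed_nonempty_isCompact_isClosed
          (fun S hS T hT => (hchain.total hS hT).elim (fun h => ⟨S, hS, subset_rfl, h⟩)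
            fun h => ⟨T, hT, h, subset_rfl⟩) (fun S hS => (hc hS).2.2.1)
          (fun S hS => (hc hS).2.1.isCompact) (fun S hS => (hc hS).2.1)
      · exact fun h χ hχ S hS => (hc hS).2.2.2 h χ (hχ S hS))
  obtain ⟨⟨hKC, hKcl, hKne, hKinv⟩, hKmin⟩ := hK
  -- Limits agree with genuine rows on finite sets, so they inherit the ladder bound.
  have hKN : ¬ HasLadder (fun (χ : K) p => χ.1 p = true) N := by
    rintro ⟨χ, p, h⟩
    choose a ha using fun i => hC _ (hKC (χ i).2) (Finset.univ.image p)
    refine hN ⟨a, p, fun i j => ?_⟩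
    rw [← h i j]
    exact ha i (p j) (Finset.mem_image_of_mem _ (Finset.mem_univ _))
  have := hKne.to_subtype
  obtain ⟨χ, s, hχ⟩ := exists_isolated_row hKN
  have hχ' : ∀ ψ ∈ K, (∀ p ∈ s, ψ p = χ.1 p) → ψ = χ.1 := fun ψ hψ h => by
    funext p
    exact Bool.eq_iff_iff.2 (hχ ⟨ψ, hψ⟩ (fun p hp => Bool.eq_iff_iff.1 (h p hp)) p)
  -- By minimality every orbit is dense in `K`, so it meets the neighbourhood isolating `χ`.
  have hcover : ∀ ψ ∈ K, ∃ h : G, ∀ p ∈ s, translate h ψ p = χ.1 p := by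
    intro ψ hψ
    have horb : ∀ h, ∀ χ ∈ Set.range (fun h => translate h ψ),
        translate h χ ∈ Set.range (fun h => translate h ψ) := by
      rintro h _ ⟨h', rfl⟩
      exact ⟨h' * h, (translate_translate _ _ _).symm⟩
    have hsub : closure (Set.range fun h => translate h ψ) ⊆ K :=
      closure_minimal (by rintro _ ⟨h, rfl⟩; exact hKinv h ψ hψ) hKcl
    have hmem := hKmin (y := closure (Set.range fun h => translate h ψ))
      ⟨hsub.trans hKC, isClosed_closure, ⟨_, subset_closure ⟨1, rfl⟩⟩, hinv_closure _ horb⟩ hsub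
      χ.2
    obtain ⟨_, h1, h, rfl⟩ := mem_closure_iff.1 hmem _ (isOpen_cylinder s χ.1) (fun _ _ => rfl)
    exact ⟨h, h1⟩
  -- The translates of that neighbourhood cover `K`, and each meets `K` in one point: compactness
  -- makes `K` finite.
  obtain ⟨t, ht⟩ := hKcl.isCompact.elim_finite_subcover
    (fun h : G => translate h ⁻¹' {ψ | ∀ p ∈ s, ψ p = χ.1 p})
    (fun h => (isOpen_cylinder s χ.1).preimage (continuous_translate h))
    (fun ψ hψ => Set.mem_iUnion.2 (hcover ψ hψ))
  refine ⟨K, (t.finite_toSet.image fun h => translate h⁻¹ χ.1).subset fun ψ hψ => ?_, hKne, hKinv,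
    fun χ hχ => hC χ (hKC hχ)⟩
  obtain ⟨h, hht, hh⟩ := Set.mem_iUnion₂.1 (ht hψ)
  refine ⟨h, hht, ?_⟩
  change translate h⁻¹ χ.1 = ψ
  rw [← hχ' _ (hKinv h ψ hψ) hh, translate_translate, mul_inv_cancel, translate_one]

/-- A stable relation `φ` between a group and a set has a "generic" predicate: it lies between
`∀ g, φ g z` and `∃ g, φ g z`, depends on finitely many instances of `φ`, and is invariant under
translation. -/
theorem exists_generic_predicate {G V : Type*} [Group G] {φ : G → V → Prop} {N : ℕ}
    (hN : ¬ HasLadder (fun (a : G) (p : G × V) => φ (a * p.1) p.2) N) :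
    ∃ Q : V → Prop, (∀ z, (∀ g, φ g z) → Q z) ∧ (∀ z, Q z → ∃ g, φ g z) ∧
      (∀ h z z', (∀ a, φ (a * h) z ↔ φ a z') → Q z → Q z') ∧
      ∃ s : Finset G, ∀ z z', (∀ g ∈ s, φ g z ↔ φ g z') → (Q z ↔ Q z') := by
  classical
  obtain ⟨K, hfin, hne, hinv, hlim⟩ := exists_finite_invariant_limits hN
  -- Quantifying over all of the invariant set `K`, not one limit, gives the invariance under
  -- translation.
  refine ⟨fun z => ∀ χ ∈ K, χ (1, z) = true, ?_, ?_, ?_, ?_⟩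
  · intro z hz χ hχ
    obtain ⟨a, ha⟩ := hlim χ hχ {(1, z)}
    exact (ha _ (Finset.mem_singleton_self _)).1 (hz _)
  · intro z hz
    obtain ⟨χ, hχ⟩ := hne
    obtain ⟨a, ha⟩ := hlim χ hχ {(1, z)}
    exact ⟨_, (ha _ (Finset.mem_singleton_self _)).2 (hz χ hχ)⟩
  · intro h z z' hzz' hQ χ hχ
    have h1 : χ (h * 1, z) = true := hQ _ (hinv h χ hχ)
    obtain ⟨a, ha⟩ := hlim χ hχ {(h * 1, z), (1, z')}
    have h2 := (ha (h * 1, z) (by simp)).2 h1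
    refine (ha (1, z') (by simp)).1 ?_
    simp only [mul_one] at h2 ⊢
    exact (hzz' a).1 h2
  · choose! s hs using fun χ (hχ : χ ∈ K) => exists_finset_factors hN (hlim χ hχ)
    refine ⟨hfin.toFinset.biUnion s, fun z z' h => forall₂_congr fun χ hχ => ?_⟩
    refine hs χ hχ (1, z) (1, z') fun a ha => ?_
    simp only [mul_one]
    exact h a (Finset.mem_biUnion.2 ⟨χ, hfin.mem_toFinset.2 hχ, ha⟩)

end Dynamics

/-! ### Clifford monoids and chains of idempotents -/

section Algebra

/-- Two pseudo-inverses `b`, `c` of `a` both equal `c * a * b`, since `b * a` and `a * b` are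
central. -/
theorem isCliffordSemigroup_of_regular {S : Type*} [Semigroup S]
    (hreg : ∀ a : S, ∃ b, a * b * a = a ∧ b * a * b = b)
    (hcent : ∀ e : S, IsIdempotentElem e → ∀ a : S, e * a = a * e) : IsCliffordSemigroup S := by
  refine ⟨fun a => ?_, hcent⟩
  obtain ⟨b, hb1, hb2⟩ := hreg a
  refine ⟨b, ⟨hb1, hb2⟩, fun c ⟨hc1, hc2⟩ => ?_⟩
  have hba : IsIdempotentElem (b * a) := by
    change b * a * (b * a) = b * a
    rw [← mul_assoc, hb2]
  have hab : IsIdempotentElem (a * b) := by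
    change a * b * (a * b) = a * b
    rw [← mul_assoc, hb1]
  have h1 : b = c * a * b := by
    calc b = b * (a * c * a) * b := by rw [hc1, hb2]
      _ = (b * a) * (c * a) * b := by simp only [mul_assoc]
      _ = (c * a) * (b * a) * b := by rw [hcent _ hba]
      _ = c * (a * b * a) * b := by simp only [mul_assoc]
      _ = c * a * b := by rw [hb1]
  have h2 : c = c * a * b := by
    calc c = c * (a * b * a) * c := by rw [hb1, hc2]
      _ = c * ((a * b) * (a * c)) := by simp only [mul_assoc]
      _ = c * ((a * c) * (a * b)) := by rw [hcent _ hab]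
      _ = (c * a * c) * (a * b) := by simp only [mul_assoc]
      _ = c * a * b := by rw [hc2, mul_assoc]
  exact h2.trans h1.symm

/-- A pseudo-inverse of `g * e` is `e * g⁻¹`. -/
theorem isSurjectiveClifford_of_decomposition {S : Type*} [Monoid S]
    (hcent : ∀ e : S, IsIdempotentElem e → ∀ a : S, e * a = a * e)
    (hdec : ∀ a : S, ∃ (g : Sˣ) (e : S), IsIdempotentElem e ∧ a = g * e) :
    IsSurjectiveClifford S := by
  refine ⟨isCliffordSemigroup_of_regular (fun a => ?_) hcent, hdec⟩
  obtain ⟨g, e, he, rfl⟩ := hdec a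
  have he' : e * e = e := he
  refine ⟨e * (g⁻¹ : Sˣ), ?_, ?_⟩
  · calc g * e * (e * (g⁻¹ : Sˣ)) * (g * e) = g * ((e * e) * ((g⁻¹ : Sˣ) * g) * e) := by
          simp only [mul_assoc]
      _ = g * e := by rw [he', Units.inv_mul, mul_one, he']
  · calc e * (g⁻¹ : Sˣ) * (g * e) * (e * (g⁻¹ : Sˣ))
        = e * ((g⁻¹ : Sˣ) * g) * (e * e) * (g⁻¹ : Sˣ) := by simp only [mul_assoc]
      _ = e * (g⁻¹ : Sˣ) := by rw [he', Units.inv_mul, mul_one, he']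

/-- Products `o y₁ ⋯ yⱼ` of `j` elements of `Y`, bracketed to the left. -/
def prodSet {V : Type*} (m : V → V → V) (o : V) (Y : Set V) : ℕ → Set V
  | 0 => {o}
  | j + 1 => {z | ∃ f y, f ∈ prodSet m o Y j ∧ y ∈ Y ∧ m f y = z}

theorem prodSet_mono {V : Type*} (m : V → V → V) (o : V) {Y Y' : Set V} (h : Y ⊆ Y') (j : ℕ) :
    prodSet m o Y j ⊆ prodSet m o Y' j := by
  induction j with
  | zero => exact subset_rfl
  | succ j ih =>
    rintro _ ⟨f, y, hf, hy, rfl⟩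
    exact ⟨f, y, ih hf, h hy, rfl⟩

/-- If commuting idempotents admit no long strictly descending chains, then their products of
bounded length form a semilattice. -/
theorem prodSet_closed {V : Type*} {m : V → V → V} {o : V} {X Y : Set V} {N : ℕ}
    (hassoc : ∀ a ∈ X, ∀ b ∈ X, ∀ c ∈ X, m (m a b) c = m a (m b c))
    (hone : ∀ a ∈ X, m a o = a)
    (hcent : ∀ e ∈ X, ∀ a ∈ X, m e e = e → m e a = m a e)
    (hoo : m o o = o) (hoY : o ∈ Y) (hYX : Y ⊆ X) (hY : ∀ y ∈ Y, m y y = y)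
    (hprod : ∀ j ≤ N + 1, prodSet m o Y j ⊆ X)
    (hN : ¬ HasLadder (fun e f => m e f = e ∧ e ≠ f) N) :
    (∀ e ∈ prodSet m o Y N, m e e = e) ∧
      (∀ e ∈ prodSet m o Y N, ∀ f ∈ prodSet m o Y N, m e f ∈ prodSet m o Y N) ∧
      Y ⊆ prodSet m o Y N := by
  have hsucc : ∀ j ≤ N + 1, prodSet m o Y j ⊆ prodSet m o Y (j + 1) := fun j hj f hf =>
    ⟨f, o, hf, hoY, hone f (hprod j hj hf)⟩
  have hle : ∀ i j, i ≤ j → j ≤ N + 1 → prodSet m o Y i ⊆ prodSet m o Y j := by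
    intro i j hij hj
    induction j, hij using Nat.le_induction with
    | base => exact subset_rfl
    | succ j _ ih => exact (ih (by omega)).trans (hsucc j (by omega))
  have hdown : ∀ f ∈ X, ∀ y ∈ Y, m f f = f → m f y ∈ X → m (m f y) f = m f y := by
    intro f hf y hy hff _
    rw [hassoc f hf y (hYX hy) f hf, hcent y (hYX hy) f hf (hY y hy),
      ← hassoc f hf f hf y (hYX hy), hff]
  have hidem : ∀ j ≤ N + 1, ∀ e ∈ prodSet m o Y j, m e e = e := by
    intro j
    induction j with
    | zero => rintro - e rfl; exact hoo
    | succ j ih =>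
      rintro hj _ ⟨f, y, hf, hy, rfl⟩
      have hfX := hprod j (by omega) hf
      have hfy : m f y ∈ X := hprod (j + 1) hj ⟨f, y, hf, hy, rfl⟩
      rw [← hassoc _ hfy f hfX y (hYX hy), hdown f hfX y hy (ih (by omega) f hf) hfy,
        hassoc f hfX y (hYX hy) y (hYX hy), hY y hy]
  -- An element that first appears at stage `j + 1` ends a descending chain whose member `c i` first
  -- appears at stage `i + 1`; hence the chain is strict.
  have hchain : ∀ j ≤ N, ∀ f ∈ prodSet m o Y (j + 1), f ∉ prodSet m o Y j →
      ∃ c : ℕ → V, c j = f ∧ (∀ i ≤ j, c i ∈ prodSet m o Y (i + 1) ∧ c i ∉ prodSet m o Y i) ∧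
        ∀ i' ≤ j, ∀ i ≤ i', m (c i') (c i) = c i' := by
    intro j
    induction j with
    | zero =>
      intro _ f hf hf'
      refine ⟨fun _ => f, rfl, fun i hi => ?_, fun _ _ _ _ => hidem 1 (by omega) f hf⟩
      obtain rfl : i = 0 := by omega
      exact ⟨hf, hf'⟩
    | succ j ih =>
      rintro hj _ ⟨f, y, hf, hy, rfl⟩ hfy
      have hf' : f ∉ prodSet m o Y j := fun h => hfy ⟨f, y, h, hy, rfl⟩
      have hfX := hprod (j + 1) (by omega) hf
      have hfyF : m f y ∈ prodSet m o Y (j + 1 + 1) := ⟨f, y, hf, hy, rfl⟩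
      have hfyX : m f y ∈ X := hprod _ (by omega) hfyF
      have hff := hidem (j + 1) (by omega) f hf
      obtain ⟨c, hcj, hc1, hc2⟩ := ih (by omega) f hf hf'
      refine ⟨Function.update c (j + 1) (m f y), by simp, fun i hi => ?_, fun i' hi' i hi => ?_⟩
      · rcases Nat.lt_or_eq_of_le hi with h | rfl
        · rw [Function.update_of_ne (by omega)]
          exact hc1 i (by omega)
        · rw [Function.update_self]
          exact ⟨hfyF, hfy⟩
      · rcases Nat.lt_or_eq_of_le hi' with h | rfl
        · rw [Function.update_of_ne (by omega), Function.update_of_ne (by omega)]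
          exact hc2 i' (by omega) i hi
        · rw [Function.update_self]
          rcases Nat.lt_or_eq_of_le hi with h | rfl
          · rw [Function.update_of_ne (by omega)]
            have hciX : c i ∈ X := hprod (i + 1) (by omega) (hc1 i (by omega)).1
            have h1 := hc2 j le_rfl i (by omega)
            rw [hcj] at h1
            have h2 := hdown f hfX y hy hff hfyX
            conv_lhs => rw [← h2]
            rw [hassoc _ hfyX f hfX _ hciX, h1, h2]
          · rw [Function.update_self]
            exact hidem _ (by omega) _ hfyF
  have hstationary : prodSet m o Y (N + 1) ⊆ prodSet m o Y N := by
    intro f hf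
    by_contra hf'
    obtain ⟨c, -, hc1, hc2⟩ := hchain N le_rfl f hf hf'
    have hne : ∀ i ≤ N, ∀ i' < i, c i ≠ c i' := by
      intro i hi i' hii' h
      refine (hc1 i hi).2 (h ▸ ?_)
      exact hle (i' + 1) i hii' (by omega) (hc1 i' (by omega)).1
    refine hN ⟨fun i => c (N - i), fun i => c (N - i), fun i j => ?_⟩
    rcases lt_trichotomy i j with h | rfl | h
    · have h' := Fin.lt_def.1 h
      exact iff_of_true ⟨hc2 _ (by omega) _ (by omega), hne _ (by omega) _ (by omega)⟩ h
    · exact iff_of_false (fun h => h.2 rfl) (lt_irrefl _)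
    · refine iff_of_false (fun ⟨h1, h2⟩ => ?_) h.asymm
      have h' := Fin.lt_def.1 h
      have h3 := hc2 (N - j) (by omega) (N - i) (by omega)
      have h4 := hprod (N - j + 1) (by omega) (hc1 (N - j) (by omega)).1
      have h5 := hprod (N - i + 1) (by omega) (hc1 (N - i) (by omega)).1
      rw [hcent _ h4 _ h5 (hc2 (N - j) (by omega) _ le_rfl), h1] at h3
      exact h2 h3
  refine ⟨hidem N (by omega), fun e he f hf => ?_, fun y hy => ?_⟩
  · suffices h : ∀ j ≤ N, ∀ f ∈ prodSet m o Y j, m e f ∈ prodSet m o Y N from h N le_rfl f hf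
    have heX := hprod N (by omega) he
    intro j
    induction j with
    | zero =>
      rintro - f rfl
      rwa [hone e heX]
    | succ j ih =>
      rintro hj _ ⟨f, y, hf, hy, rfl⟩
      rw [← hassoc e heX f (hprod j (by omega) hf) y (hYX hy)]
      exact hstationary ⟨_, y, ih (by omega) f hf, hy, rfl⟩
  · refine hstationary (hle 1 (N + 1) (by omega) le_rfl ⟨o, y, rfl, hy, ?_⟩)
    have hoX := hYX hoY
    rw [hcent o hoX y (hYX hy) hoo, hone y (hYX hy)]

end Algebra

/-! ### Definable envelopes of idempotents, units and the monoid -/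

section Envelopes

variable {L : FirstOrder.Language.{u, v}} {U : Type w} [L.Structure U] {κ : Cardinal.{w}} {n : ℕ}
  {m : (Fin n → U) → (Fin n → U) → (Fin n → U)}

/-- A binary operation on `n`-tuples is definable. -/
abbrev IsDefOp (L : FirstOrder.Language.{u, v}) {U : Type w} [L.Structure U] {n : ℕ}
    (m : (Fin n → U) → (Fin n → U) → (Fin n → U)) : Prop :=
  IsDefMap L fun x : Fin n ⊕ Fin n → U => m (fun j => x (.inl j)) (fun j => x (.inr j))

theorem IsDefOp.apply (hm : IsDefOp L m) {α : Type} {S T : (α → U) → (Fin n → U)}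
    (hS : IsDefMap L S) (hT : IsDefMap L T) : IsDefMap L fun x => m (S x) (T x) :=
  IsDefMap.comp (T := fun x : Fin n ⊕ Fin n → U => m (fun j => x (.inl j)) (fun j => x (.inr j)))
    hm (hS.sumElim hT)

theorem isDefinable_prodSet (hm : IsDefOp L m) (o : Fin n → U) {Y : Set (Fin n → U)}
    (hY : IsDefinable L Y) (j : ℕ) : IsDefinable L (prodSet m o Y j) := by
  induction j with
  | zero => exact isDefinable_eq (IsDefMap.proj id) (IsDefMap.const o)
  | succ j ih =>
    exact isDefinable_exists (isDefinable_exists (isDefinable_and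
      (isDefinable_mem (IsDefMap.proj _) ih) (isDefinable_and
        (isDefinable_mem (IsDefMap.proj _) hY)
        (isDefinable_eq (hm.apply (IsDefMap.proj _) (IsDefMap.proj _)) (IsDefMap.proj _)))))

/-- A definable superset of `M` that multiplies into a given one. -/
theorem exists_superset_mul_subset (hκ : ℵ₀ ≤ κ) (hU : IsKappaCompact L U κ)
    {M : Set (Fin n → U)} (hM : IsInfDefinable L κ M) (hm : IsDefOp L m)
    (hmul : ∀ a ∈ M, ∀ b ∈ M, m a b ∈ M) {X : Set (Fin n → U)} (hX : IsDefinable L X)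
    (hMX : M ⊆ X) :
    ∃ Y, IsDefinable L Y ∧ M ⊆ Y ∧ Y ⊆ X ∧ ∀ a ∈ Y, ∀ b ∈ Y, m a b ∈ X := by
  obtain ⟨Y, hY, hMY, h⟩ := hM.exists_superset hκ hU (ι := Fin 2) (P := fun t => m (t 0) (t 1) ∈ X)
    (isDefinable_mem (hm.apply (IsDefMap.proj _) (IsDefMap.proj _)) hX)
    (fun t ht => hMX (hmul _ (ht 0) _ (ht 1)))
  refine ⟨Y ∩ X, hY.inter hX, Set.subset_inter hMY hMX, Set.inter_subset_right,
    fun a ha b hb => h ![a, b] fun i => ?_⟩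
  fin_cases i
  · exact ha.1
  · exact hb.1

/-- Iterates `exists_superset_mul_subset`, so that bounded products stay where the axioms hold. -/
theorem exists_superset_prodSet_subset (hκ : ℵ₀ ≤ κ) (hU : IsKappaCompact L U κ)
    {M : Set (Fin n → U)} (hM : IsInfDefinable L κ M) (hm : IsDefOp L m) {o : Fin n → U}
    (ho : o ∈ M) (hmul : ∀ a ∈ M, ∀ b ∈ M, m a b ∈ M) (r : ℕ) {X : Set (Fin n → U)}
    (hX : IsDefinable L X) (hMX : M ⊆ X) :
    ∃ Y, IsDefinable L Y ∧ M ⊆ Y ∧ Y ⊆ X ∧ ∀ j ≤ r, prodSet m o Y j ⊆ X := by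
  induction r generalizing X with
  | zero =>
    refine ⟨X, hX, hMX, subset_rfl, fun j hj => ?_⟩
    obtain rfl : j = 0 := by omega
    rintro _ rfl
    exact hMX ho
  | succ r ih =>
    obtain ⟨X', hX', hMX', hX'X, hX'mul⟩ := exists_superset_mul_subset hκ hU hM hm hmul hX hMX
    obtain ⟨Y, hY, hMY, hYX, hprod⟩ := ih hX' hMX'
    refine ⟨Y, hY, hMY, hYX.trans hX'X, fun j hj => ?_⟩
    cases j with
    | zero => rintro _ rfl; exact hMX ho
    | succ j =>
      rintro _ ⟨f, y, hf, hy, rfl⟩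
      exact hX'mul _ (hprod j (by omega) hf) _ (hYX hy)

/-- The central idempotents of an `∞`-definable monoid lie in a definable semilattice. -/
theorem exists_semilattice_envelope (hst : IsStable L U) (hκ : ℵ₀ ≤ κ)
    (hU : IsKappaCompact L U κ) {M : Set (Fin n → U)} (hM : IsInfDefinable L κ M)
    (hm : IsDefOp L m) {o : Fin n → U} (ho : o ∈ M) (hmul : ∀ a ∈ M, ∀ b ∈ M, m a b ∈ M)
    {X₀ X : Set (Fin n → U)} (hX : IsDefinable L X) (hMX : M ⊆ X) (hXX₀ : X ⊆ X₀)
    (hassoc : ∀ a ∈ X₀, ∀ b ∈ X₀, ∀ c ∈ X₀, m (m a b) c = m a (m b c))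
    (hone : ∀ a ∈ X₀, m a o = a)
    (hcent : ∀ e ∈ X₀, ∀ a ∈ X₀, m e e = e → m e a = m a e) :
    ∃ F, IsDefinable L F ∧ F ⊆ X ∧ (∀ e ∈ M, m e e = e → e ∈ F) ∧ (∀ e ∈ F, m e e = e) ∧
      ∀ e ∈ F, ∀ f ∈ F, m e f ∈ F := by
  -- The strict order on idempotents does not mention `Y`, so the number of factors is known before
  -- `Y` is chosen.
  obtain ⟨N, hN⟩ := hst.exists_not_hasLadder
    (R := fun e f : Fin n → U => m e f = e ∧ e ≠ f)
    (isDefinable_and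
      (isDefinable_eq (hm.apply (IsDefMap.proj _) (IsDefMap.proj _)) (IsDefMap.proj _))
      (isDefinable_not (isDefinable_eq (IsDefMap.proj _) (IsDefMap.proj _))))
  obtain ⟨Y, hY, hMY, hYX, hprod⟩ :=
    exists_superset_prodSet_subset hκ hU hM hm ho hmul (N + 1) hX hMX
  have hoo : m o o = o := hone o (hXX₀ (hMX ho))
  have hsub : ∀ j ≤ N + 1, prodSet m o {y | y ∈ Y ∧ m y y = y} j ⊆ X := fun j hj =>
    (prodSet_mono m o (fun _ h => h.1) j).trans (hprod j hj)
  obtain ⟨h1, h2, h3⟩ := prodSet_closed (Y := {y | y ∈ Y ∧ m y y = y}) hassoc hone hcent hoo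
    ⟨hMY ho, hoo⟩ (fun y hy => hXX₀ (hYX hy.1)) (fun y hy => hy.2)
    (fun j hj => (hsub j hj).trans hXX₀) hN
  refine ⟨_, isDefinable_prodSet hm o (isDefinable_and hY (isDefinable_eq
    (hm.apply (IsDefMap.proj id) (IsDefMap.proj id)) (IsDefMap.proj id))) N,
    hsub N (by omega), fun e he hee => h3 ⟨hMY he, hee⟩, h1, h2⟩

/-- The units of an `∞`-definable monoid lie in a definable group. -/
theorem exists_group_envelope (hst : IsStable L U) (hκ : ℵ₀ ≤ κ)
    (hU : IsKappaCompact L U κ) {M : Set (Fin n → U)} [Monoid M] (hM : IsInfDefinable L κ M)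
    (hm : IsDefOp L m) (hmM : ∀ a b : M, m a.1 b.1 = (a * b).1)
    {X₀ X : Set (Fin n → U)} (hX : IsDefinable L X) (hMX : M ⊆ X) (hXX₀ : X ⊆ X₀)
    (hassoc : ∀ a ∈ X₀, ∀ b ∈ X₀, ∀ c ∈ X₀, m (m a b) c = m a (m b c))
    (hone : ∀ a ∈ X₀, m (1 : M).1 a = a) :
    ∃ H, IsDefinable L H ∧ H ⊆ X ∧ (∀ g : Mˣ, g.1.1 ∈ H) ∧
      (∀ a ∈ H, ∀ b ∈ H, m a b ∈ H) ∧
      ∀ a ∈ H, ∃ b ∈ H, m a b = (1 : M).1 ∧ m b a = (1 : M).1 := by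
  obtain ⟨Y, hY, hMY, hYX, hYmul⟩ := exists_superset_mul_subset hκ hU hM hm
    (fun a ha b hb => by rw [hmM ⟨a, ha⟩ ⟨b, hb⟩]; exact Subtype.property _) hX hMX
  have hMX₀ := hMX.trans hXX₀
  -- The extra middle factor accounts for translation by units.
  obtain ⟨N, hN⟩ := hst.exists_not_hasLadder
    (R := fun (x : Fin n → U) (p : Fin n ⊕ Fin n → U) =>
      m (m x fun j => p (.inl j)) (fun j => p (.inr j)) ∈ Y)
    (isDefinable_mem (hm.apply (hm.apply (IsDefMap.proj _) (IsDefMap.proj _)) (IsDefMap.proj _)) hY)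
  obtain ⟨Q, hQ1, hQ2, hQ3, s, hs⟩ := exists_generic_predicate (G := Mˣ)
    (φ := fun g (z : Fin n → U) => m g.1.1 z ∈ Y) (N := N) (by
      rintro ⟨a, b, h⟩
      refine hN ⟨fun i => (a i).1.1, fun j => Sum.elim (b j).1.1.1 (b j).2, fun i j => ?_⟩
      rw [← h i j]
      simp only [Sum.elim_inl, Sum.elim_inr, Units.val_mul, ← hmM])
  -- Products of two elements of `Y` are needed for invariance: if `g * z` is in `Y`, then `h * z =
  -- (h * g⁻¹) * (g * z)`.
  let Z : Set (Fin n → U) := {z | (∃ u v, u ∈ Y ∧ v ∈ Y ∧ m u v = z) ∧ Q z}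
  have hZ : IsDefinable L Z := by
    refine isDefinable_and (isDefinable_exists (isDefinable_exists (isDefinable_and
      (isDefinable_mem (IsDefMap.proj _) hY) (isDefinable_and
        (isDefinable_mem (IsDefMap.proj _) hY)
        (isDefinable_eq (hm.apply (IsDefMap.proj _) (IsDefMap.proj _)) (IsDefMap.proj _))))))
      (isDefinable_of_finite_invariant s (fun g z => m g.1.1 z ∈ Y) (fun g => ?_) hs)
    exact isDefinable_mem (hm.apply (IsDefMap.const _) (IsDefMap.proj id)) hY
  have hZX : Z ⊆ X := by
    rintro _ ⟨⟨u, v, hu, hv, rfl⟩, -⟩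
    exact hYmul u hu v hv
  have hZX₀ := hZX.trans hXX₀
  have hinv : ∀ h : Mˣ, ∀ z ∈ Z, m h.1.1 z ∈ Z := by
    intro h z hz
    obtain ⟨g, hg⟩ := hQ2 z hz.2
    have hz' : z = m (g⁻¹ : Mˣ).1.1 (m g.1.1 z) := by
      rw [← hassoc _ (hMX₀ (Subtype.property _)) _ (hMX₀ (Subtype.property _)) z (hZX₀ hz), hmM,
        Units.inv_mul, hone z (hZX₀ hz)]
    refine ⟨⟨(h * g⁻¹ : Mˣ).1.1, m g.1.1 z, hMY (Subtype.property _), hg, ?_⟩,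
      hQ3 h z _ (fun a => ?_) hz.2⟩
    · conv_rhs => rw [hz']
      rw [Units.val_mul, ← hmM]
      exact hassoc _ (hMX₀ (Subtype.property _)) _ (hMX₀ (Subtype.property _)) _
        (hXX₀ (hYX hg))
    · rw [Units.val_mul, ← hmM, hassoc _ (hMX₀ (Subtype.property _)) _
        (hMX₀ (Subtype.property _)) z (hZX₀ hz)]
  have hunit : ∀ g : Mˣ, g.1.1 ∈ Z := fun g =>
    ⟨⟨(1 : M).1, g.1.1, hMY (Subtype.property _), hMY (Subtype.property _),
      hone _ (hMX₀ (Subtype.property _))⟩,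
      hQ1 _ fun a => by rw [hmM]; exact hMY (Subtype.property _)⟩
  let H : Set (Fin n → U) := {a | a ∈ Z ∧ (∀ z, z ∈ Z → m a z ∈ Z) ∧
    ∃ b, b ∈ Z ∧ (∀ z, z ∈ Z → m b z ∈ Z) ∧ m a b = (1 : M).1 ∧ m b a = (1 : M).1}
  have hH : IsDefinable L H := by
    refine isDefinable_and hZ (isDefinable_and (isDefinable_forall (isDefinable_imp
      (isDefinable_mem (IsDefMap.proj _) hZ)
      (isDefinable_mem (hm.apply (IsDefMap.proj _) (IsDefMap.proj _)) hZ)))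
      (isDefinable_exists (isDefinable_and (isDefinable_mem (IsDefMap.proj _) hZ)
        (isDefinable_and (isDefinable_forall (isDefinable_imp
          (isDefinable_mem (IsDefMap.proj _) hZ)
          (isDefinable_mem (hm.apply (IsDefMap.proj _) (IsDefMap.proj _)) hZ)))
        (isDefinable_and
          (isDefinable_eq (hm.apply (IsDefMap.proj _) (IsDefMap.proj _)) (IsDefMap.const _))
          (isDefinable_eq (hm.apply (IsDefMap.proj _) (IsDefMap.proj _)) (IsDefMap.const _)))))))
  have hcancel : ∀ a ∈ Z, ∀ b ∈ Z, ∀ b' ∈ Z, ∀ a' ∈ Z, m b' a' ∈ Z → m b b' = (1 : M).1 →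
      m a a' = (1 : M).1 → m (m a b) (m b' a') = (1 : M).1 := by
    intro a ha b hb b' hb' a' ha' hba hbb haa
    rw [hassoc a (hZX₀ ha) b (hZX₀ hb) _ (hZX₀ hba),
      ← hassoc b (hZX₀ hb) b' (hZX₀ hb') a' (hZX₀ ha'), hbb, hone a' (hZX₀ ha'), haa]
  have hstab : ∀ a ∈ Z, (∀ z, z ∈ Z → m a z ∈ Z) → ∀ b ∈ Z, (∀ z, z ∈ Z → m b z ∈ Z) →
      ∀ z, z ∈ Z → m (m a b) z ∈ Z := by
    intro a ha ha' b hb hb' z hz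
    rw [hassoc a (hZX₀ ha) b (hZX₀ hb) z (hZX₀ hz)]
    exact ha' _ (hb' z hz)
  refine ⟨H, hH, fun a ha => hZX ha.1, fun g => ?_, ?_, ?_⟩
  · refine ⟨hunit g, hinv g, (g⁻¹ : Mˣ).1.1, hunit _, hinv _, ?_, ?_⟩
    · rw [hmM, Units.mul_inv]
    · rw [hmM, Units.inv_mul]
  · rintro a ⟨ha, ha', c, hc, hc', hac, hca⟩ b ⟨hb, hb', d, hd, hd', hbd, hdb⟩
    exact ⟨ha' b hb, hstab a ha ha' b hb hb', m d c, hd' c hc, hstab d hd hd' c hc hc',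
      hcancel a ha b hb d hd c hc (hd' c hc) hbd hac,
      hcancel d hd c hc a ha b hb (ha' b hb) hca hdb⟩
  · rintro a ⟨ha, ha', b, hb, hb', hab, hba⟩
    exact ⟨b, ⟨hb, hb', a, ha, ha', hba, hab⟩, hab, hba⟩

/-- An `∞`-definable surjective Clifford monoid lies in a definable one inside any given definable
superset. -/
theorem exists_surjectiveClifford_envelope (hst : IsStable L U) (hκ : ℵ₀ ≤ κ)
    (hU : IsKappaCompact L U κ) {M : Set (Fin n → U)} [Monoid M]
    (hM : IsInfDefinableMonoid L κ M) (hMC : IsSurjectiveClifford M) {D : Set (Fin n → U)}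
    (hD : IsDefinable L D) (hMD : M ⊆ D) :
    ∃ N ⊆ D, ∃ _ : Monoid N, IsDefinableMonoid L N ∧ IsSurjectiveClifford N ∧ Extends N M := by
  obtain ⟨m, hm, hmM⟩ := exists_definable_mul hκ hU hM.2
  replace hm : IsDefOp L m := hm
  have hmul : ∀ a ∈ M, ∀ b ∈ M, m a b ∈ M := fun a ha b hb => by
    rw [hmM ⟨a, ha⟩ ⟨b, hb⟩]; exact Subtype.property _
  obtain ⟨X₁, hX₁, hMX₁, h₁⟩ := hM.1.exists_superset hκ hU (ι := Fin 3)
    (P := fun t => t 0 ∈ D ∧ m (m (t 0) (t 1)) (t 2) = m (t 0) (m (t 1) (t 2)) ∧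
      m (1 : M).1 (t 0) = t 0 ∧ m (t 0) (1 : M).1 = t 0 ∧
      (m (t 0) (t 0) = t 0 → m (t 0) (t 1) = m (t 1) (t 0)))
    (isDefinable_and (isDefinable_mem (IsDefMap.proj _) hD) (isDefinable_and
      (isDefinable_eq (hm.apply (hm.apply (IsDefMap.proj _) (IsDefMap.proj _)) (IsDefMap.proj _))
        (hm.apply (IsDefMap.proj _) (hm.apply (IsDefMap.proj _) (IsDefMap.proj _))))
      (isDefinable_and
        (isDefinable_eq (hm.apply (IsDefMap.const _) (IsDefMap.proj _)) (IsDefMap.proj _))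
        (isDefinable_and
          (isDefinable_eq (hm.apply (IsDefMap.proj _) (IsDefMap.const _)) (IsDefMap.proj _))
          (isDefinable_imp
            (isDefinable_eq (hm.apply (IsDefMap.proj _) (IsDefMap.proj _)) (IsDefMap.proj _))
            (isDefinable_eq (hm.apply (IsDefMap.proj _) (IsDefMap.proj _))
              (hm.apply (IsDefMap.proj _) (IsDefMap.proj _))))))))
    (by
      intro t ht
      obtain ⟨a, ha⟩ : ∃ a : M, a.1 = t 0 := ⟨⟨_, ht 0⟩, rfl⟩
      obtain ⟨b, hb⟩ : ∃ b : M, b.1 = t 1 := ⟨⟨_, ht 1⟩, rfl⟩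
      obtain ⟨c, hc⟩ : ∃ c : M, c.1 = t 2 := ⟨⟨_, ht 2⟩, rfl⟩
      simp only [← ha, ← hb, ← hc, hmM, mul_assoc, one_mul, mul_one, true_and]
      exact ⟨hMD a.2, fun h => congrArg _ (hMC.1.2 a (Subtype.ext h) b)⟩)
  have h₁' : ∀ a ∈ X₁, ∀ b ∈ X₁, ∀ c ∈ X₁, a ∈ D ∧ m (m a b) c = m a (m b c) ∧
      m (1 : M).1 a = a ∧ m a (1 : M).1 = a ∧ (m a a = a → m a b = m b a) :=
    fun a ha b hb c hc => h₁ ![a, b, c] fun i => by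
      fin_cases i
      exacts [ha, hb, hc]
  have hassoc : ∀ a ∈ X₁, ∀ b ∈ X₁, ∀ c ∈ X₁, m (m a b) c = m a (m b c) :=
    fun a ha b hb c hc => (h₁' a ha b hb c hc).2.1
  have hone_mul : ∀ a ∈ X₁, m (1 : M).1 a = a := fun a ha => (h₁' a ha a ha a ha).2.2.1
  have hmul_one : ∀ a ∈ X₁, m a (1 : M).1 = a := fun a ha => (h₁' a ha a ha a ha).2.2.2.1
  have hcent : ∀ e ∈ X₁, ∀ a ∈ X₁, m e e = e → m e a = m a e :=
    fun e he a ha => (h₁' e he a ha a ha).2.2.2.2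
  -- Both envelopes are taken inside `X₂`, which puts their product `N` inside `X₁`, where the
  -- axioms hold.
  obtain ⟨X₂, hX₂, hMX₂, hX₂₁, hX₂mul⟩ := exists_superset_mul_subset hκ hU hM.1 hm hmul hX₁ hMX₁
  obtain ⟨F, hF, hFX, hMF, hFidem, hFmul⟩ := exists_semilattice_envelope hst hκ hU hM.1 hm
    (1 : M).2 hmul hX₂ hMX₂ hX₂₁ hassoc hmul_one hcent
  obtain ⟨H, hH, hHX, hMH, hHmul, hHinv⟩ := exists_group_envelope hst hκ hU hM.1 hm hmM
    hX₂ hMX₂ hX₂₁ hassoc hone_mul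
  have hFX₁ := hFX.trans hX₂₁
  have hHX₁ := hHX.trans hX₂₁
  let N : Set (Fin n → U) := {z | ∃ h f, h ∈ H ∧ f ∈ F ∧ m h f = z}
  have hN : IsDefinable L N := isDefinable_exists (isDefinable_exists (isDefinable_and
    (isDefinable_mem (IsDefMap.proj _) hH) (isDefinable_and
      (isDefinable_mem (IsDefMap.proj _) hF)
      (isDefinable_eq (hm.apply (IsDefMap.proj _) (IsDefMap.proj _)) (IsDefMap.proj _)))))
  have hNX : N ⊆ X₁ := by
    rintro _ ⟨h, f, hh, hf, rfl⟩
    exact hX₂mul h (hHX hh) f (hFX hf)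
  have hNmul : ∀ a ∈ N, ∀ b ∈ N, m a b ∈ N := by
    rintro _ ⟨h, f, hh, hf, rfl⟩ _ ⟨h', f', hh', hf', rfl⟩
    have hf₁ := hFX₁ hf
    have hh₁ := hHX₁ hh
    have hf₁' := hFX₁ hf'
    have hh₁' := hHX₁ hh'
    refine ⟨m h h', m f f', hHmul h hh h' hh', hFmul f hf f' hf', ?_⟩
    rw [hassoc h hh₁ f hf₁ _ (hNX ⟨h', f', hh', hf', rfl⟩), ← hassoc f hf₁ h' hh₁' f' hf₁',
      hcent f hf₁ h' hh₁' (hFidem f hf), hassoc h' hh₁' f hf₁ f' hf₁',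
      hassoc h hh₁ h' hh₁' _ (hFX₁ (hFmul f hf f' hf'))]
  have hMN : M ⊆ N := by
    intro a ha
    obtain ⟨g, e, he, hge⟩ := hMC.2 ⟨a, ha⟩
    refine ⟨g.1.1, e.1, hMH g, hMF e.1 e.2 ?_, ?_⟩
    · rw [hmM, he]
    · rw [hmM, ← hge]
  have h1F : (1 : M).1 ∈ F := hMF _ (1 : M).2 (by rw [hmM, mul_one])
  have h1H : (1 : M).1 ∈ H := hMH 1
  have hHN : H ⊆ N := fun h hh => ⟨h, _, hh, h1F, hmul_one h (hHX₁ hh)⟩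
  have hFN : F ⊆ N := fun f hf => ⟨_, f, h1H, hf, hone_mul f (hFX₁ hf)⟩
  let inst : Monoid N :=
    { mul := fun a b => ⟨m a.1 b.1, hNmul _ a.2 _ b.2⟩
      one := ⟨(1 : M).1, hMN (1 : M).2⟩
      mul_assoc := fun a b c => Subtype.ext (hassoc _ (hNX a.2) _ (hNX b.2) _ (hNX c.2))
      one_mul := fun a => Subtype.ext (hone_mul _ (hNX a.2))
      mul_one := fun a => Subtype.ext (hmul_one _ (hNX a.2)) }
  have hmulN : ∀ a b : N, (a * b).1 = m a.1 b.1 := fun _ _ => rfl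
  refine ⟨N, fun a ha => (h₁' a (hNX ha) a (hNX ha) a (hNX ha)).1, inst, ⟨hN, ?_⟩, ?_, hMN,
    fun a b => Subtype.ext (hmM a b).symm, rfl⟩
  · have : mulGraph N = {t : Fin n ⊕ Fin n ⊕ Fin n → U | (fun j => t (.inl j)) ∈ N ∧
        (fun j => t (.inr (.inl j))) ∈ N ∧
        m (fun j => t (.inl j)) (fun j => t (.inr (.inl j))) = fun j => t (.inr (.inr j))} := by
      ext t
      constructor
      · rintro ⟨a, b, rfl⟩
        exact ⟨a.2, b.2, rfl⟩
      · rintro ⟨ha, hb, hab⟩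
        refine ⟨⟨_, ha⟩, ⟨_, hb⟩, ?_⟩
        rw [hmulN, hab]
        ext (j | j | j) <;> rfl
    rw [this]
    exact isDefinable_and (isDefinable_mem (IsDefMap.proj _) hN) (isDefinable_and
      (isDefinable_mem (IsDefMap.proj _) hN)
      (isDefinable_eq (hm.apply (IsDefMap.proj _) (IsDefMap.proj _)) (IsDefMap.proj _)))
  · refine isSurjectiveClifford_of_decomposition (fun e he a => Subtype.ext
      (hcent _ (hNX e.2) _ (hNX a.2) (congrArg Subtype.val he))) ?_
    rintro ⟨_, h, f, hh, hf, rfl⟩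
    obtain ⟨h', hh', h1, h2⟩ := hHinv h hh
    exact ⟨⟨⟨h, hHN hh⟩, ⟨h', hHN hh'⟩, Subtype.ext h1, Subtype.ext h2⟩, ⟨f, hFN hf⟩,
      Subtype.ext (hFidem f hf), rfl⟩

end Envelopes

end StableMonoid

theorem theoremT {L : FirstOrder.Language.{u, v}} {U : Type w} [L.Structure U]
    (hstable : StableMonoid.IsStable L U)
    (κ : Cardinal.{w}) (hκ : ℵ₀ ≤ κ) (hU : StableMonoid.IsKappaCompact L U κ)
    {n : ℕ} (M : Set (Fin n → U)) [Monoid M]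
    (hM : StableMonoid.IsInfDefinableMonoid L κ M)
    (hClifford : StableMonoid.IsSurjectiveClifford M) :
    (∃ (N : Set (Fin n → U)) (_ : Monoid N),
      StableMonoid.IsDefinableMonoid L N ∧ StableMonoid.IsSurjectiveClifford N ∧
        StableMonoid.Extends N M) ∧
    (∃ F : Set (Set (Fin n → U)), #F < κ ∧ F.Nonempty ∧
      (∀ N ∈ F, ∃ _ : Monoid N,
        StableMonoid.IsDefinableMonoid L N ∧ StableMonoid.IsSurjectiveClifford N ∧
          StableMonoid.Extends N M) ∧
      M = ⋂₀ F) := by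
  obtain ⟨F₀, hF₀κ, hF₀, hMF₀⟩ := hM.1
  -- The extra index `none`, with the whole space, keeps the family non-empty even if `F₀` is empty.
  let D : Option F₀ → Set (Fin n → U) := fun o => o.elim Set.univ Subtype.val
  have hD : ∀ o, StableMonoid.IsDefinable L (D o) := by
    rintro (_ | Z)
    · exact Set.definable_univ
    · exact hF₀ _ Z.2
  have hMD : ∀ o, M ⊆ D o := by
    rintro (_ | Z)
    · exact Set.subset_univ _
    · rw [hMF₀]; exact Set.sInter_subset_of_mem Z.2
  choose N hND hN using fun o =>
    StableMonoid.exists_surjectiveClifford_envelope hstable hκ hU hM hClifford (hD o) (hMD o)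
  refine ⟨⟨N none, hN none⟩, Set.range N, ?_, ⟨_, none, rfl⟩, ?_, ?_⟩
  · exact mk_range_le.trans_lt (StableMonoid.mk_option_lt hκ hF₀κ)
  · rintro _ ⟨o, rfl⟩
    exact hN o
  · refine subset_antisymm ?_ ?_
    · rintro x hx _ ⟨o, rfl⟩
      obtain ⟨_, -, -, h, -⟩ := hN o
      exact h hx
    · intro x hx
      rw [hMF₀]
      exact fun Z hZ => hND (some ⟨Z, hZ⟩) (hx _ ⟨some ⟨Z, hZ⟩, rfl⟩)
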